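/- Let $n\in\mathbb N$ and $T>0$. Consider the operator on $[0,T]\times\mathbb R^n$ $$\mathcal L u=\partial_t u+\sum_{i,j=1}^n\partial_{x_i}\bigl(a_{i,j}(t)\,\partial_{x_j}u\bigr)+\sum_{j=1}^n b_j(t)\,\partial_{x_j}u+c(t)\,u ,$$ whose coefficients depend on time only, $a_{i,j}$ being real valued and $b_j$, $c$ complex valued. A modulus of continuity is a continuous, increasing, concave function $\omega:[0,1]\to[0,1]$ with $\omega(0)=0$ and $\omega(s)>0$ for $s\in(0,1]$; it satisfies the Osgood condition if $\int_0^1\frac{ds}{\omega(s)}=+\infty$. Let $\omega$ be a modulus of continuity that satisfies the Osgood condition, and let $k_A,k_B,k_C>0$. We say that $\mathcal L$ is admissible if * $a_{i,j}(t)=a_{j,i}(t)$ for all $t\in[0,T]$ and all $i,j$; * $k_A|\xi|^2\le\sum_{i,j=1}^n a_{i,j}(t)\xi_i\xi_j\le k_A^{-1}|\xi|^2$ for all $(t,\xi)\in[0,T]\times\mathbb R^n$; * $|b_i(t)|\le k_B$ and $|c(t)|\le k_C$ for all $t\in[0,T]$ and all $i$; * $a_{i,j}\in C^\omega([0,T])$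 for all $i,j$, that is, $\sup\bigl\{|a_{i,j}(t)-a_{i,j}(s)|/\omega(|t-s|) : t,s\in[0,T],\ 0<|t-s|<1\bigr\}<+\infty$. Let $L^2=L^2(\mathbb R^n;\mathbb C)$, $H^1=H^1(\mathbb R^n;\mathbb C)$ and $$\mathcal H_0=C([0,T],L^2)\cap C([0,T),H^1)\cap C^1([0,T),L^2).$$ A function $u\in\mathcal H_0$ is a solution of $\mathcal L u=0$ on $[0,T]$ if the equation holds in the sense of distributions on $\mathbb R^n$ for almost every $t\in(0,T)$. **Theorem.** For every $T'\in(0,T)$ and every $D>0$ there exist $\rho'>0$ and a strictly increasing continuous function $G:[0,+\infty)\to[0,+\infty)$ with $G(0)=0$, depending only on $k_A,k_B,k_C,\omega,n,T,T'$ and $D$, such that the following holds for every admissible operator $\mathcal L$: if $u\in\mathcal H_0$ is a solution of $\mathcal L u=0$ on $[0,T]$ with $\|u(t,\cdot)\|_{L^2}\le D$ for all $t\in[0,T]$ and $\|u(0,\cdot)\|_{L^2}\le\rho'$, then $$\sup_{t\in[0,T']}\|u(t,\cdot)\|_{L^2}^2\le G\bigl(\|u(0,\cdot)\|_{L^2}^2\bigr).$$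 -/

import Mathlib

open MeasureTheory Set
open scoped NNReal ENNReal LineDeriv

namespace BackwardParabolic

/-- Euclidean space of dimension `n`. -/
abbrev Space (n : ℕ) := EuclideanSpace ℝ (Fin n)

/-- The complex Lebesgue space of square integrable functions on Euclidean space. -/
noncomputable abbrev L2 (n : ℕ) := Lp ℂ 2 (volume : Measure (Space n))

/-- The `i`-th vector of the standard basis. -/
noncomputable abbrev e {n : ℕ} (i : Fin n) : Space n := EuclideanSpace.single i (1 : ℝ)

/-- A modulus of continuity: a function `μ : [0,1] → [0,1]`, continuous, increasing, concave, with
`μ 0 = 0`. Only the values on `[0,1]` matter. The increase may be weak, but `μ` is positive on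
`(0,1]`, so that dividing by it makes sense. -/
structure IsModulusOfContinuity (μ : ℝ → ℝ) : Prop where
  mapsTo : MapsTo μ (Icc 0 1) (Icc 0 1)
  continuousOn : ContinuousOn μ (Icc 0 1)
  monotoneOn : MonotoneOn μ (Icc 0 1)
  concaveOn : ConcaveOn ℝ (Icc 0 1) μ
  map_zero : μ 0 = 0
  pos : ∀ s ∈ Ioc (0 : ℝ) 1, 0 < μ s

/-- The Osgood condition: the integral of `1 / μ` over `(0,1)` is infinite. -/
def OsgoodCondition (μ : ℝ → ℝ) : Prop :=
  ∫⁻ s in Ioo (0 : ℝ) 1, ENNReal.ofReal (1 / μ s) = ∞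

/-- `f` has regularity `μ` on `I`: the quotients `|f t - f s| / μ |t - s|` are bounded over
`t, s ∈ I` with `0 < |t - s| < 1`. -/
def HasRegularityOn (μ f : ℝ → ℝ) (I : Set ℝ) : Prop :=
  ∃ C : ℝ, ∀ t ∈ I, ∀ s ∈ I, 0 < |t - s| → |t - s| < 1 → |f t - f s| / μ |t - s| ≤ C

/-- The coefficients, depending on time only, of the operator
`u ↦ ∂ₜ u + ∑ i j, ∂ᵢ (aᵢⱼ(t) ∂ⱼ u) + ∑ j, bⱼ(t) ∂ⱼ u + c(t) u`. -/
structure Coefficients (n : ℕ) where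
  a : Fin n → Fin n → ℝ → ℝ
  b : Fin n → ℝ → ℂ
  c : ℝ → ℂ

/-- The standing assumptions on the coefficients over `[0,T]`, with ellipticity constant `kA`,
bounds `kB`, `kC` for the lower order coefficients, and modulus of continuity `ω` for the
leading ones. -/
structure Coefficients.Admissible {n : ℕ} (L : Coefficients n) (T kA kB kC : ℝ) (ω : ℝ → ℝ) :
    Prop where
  symm : ∀ t ∈ Icc 0 T, ∀ i j, L.a i j t = L.a j i t
  lower : ∀ t ∈ Icc 0 T, ∀ ξ : Space n,
    kA * ‖ξ‖ ^ 2 ≤ ∑ i, ∑ j, L.a i j t * ξ i * ξ j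
  upper : ∀ t ∈ Icc 0 T, ∀ ξ : Space n,
    ∑ i, ∑ j, L.a i j t * ξ i * ξ j ≤ kA⁻¹ * ‖ξ‖ ^ 2
  bound_b : ∀ t ∈ Icc 0 T, ∀ i, ‖L.b i t‖ ≤ kB
  bound_c : ∀ t ∈ Icc 0 T, ‖L.c t‖ ≤ kC
  regularity : ∀ i j, HasRegularityOn ω (L.a i j) (Icc 0 T)

/-- The space `C([0,T], L²) ∩ C([0,T), H¹) ∩ C¹([0,T), L²)`. The derivative of an `L²` function is
taken in the sense of distributions, and continuity into `H¹` means that the function and its first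
partial derivatives are continuous into `L²`. -/
structure MemH0 {n : ℕ} (T : ℝ) (u : ℝ → L2 n) : Prop where
  continuousOn : ContinuousOn u (Icc 0 T)
  continuousOn_H1 : ∃ v : Fin n → ℝ → L2 n, ∀ i, ContinuousOn (v i) (Ico 0 T) ∧
    ∀ t ∈ Ico 0 T, ∂_{e i} (u t : TemperedDistribution (Space n) ℂ) = v i t
  contDiffOn : ContDiffOn ℝ 1 u (Ico 0 T)

/-- The spatial part of the operator at time `t`, acting on tempered distributions. -/
noncomputable def Coefficients.spatial {n : ℕ} (L : Coefficients n) (t : ℝ)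
    (w : TemperedDistribution (Space n) ℂ) : TemperedDistribution (Space n) ℂ :=
  (∑ i, ∑ j, ∂_{e i} ((L.a i j t : ℂ) • ∂_{e j} w)) + (∑ j, L.b j t • ∂_{e j} w) + L.c t • w

/-- `u` solves the homogeneous equation on `[0,T]`: at almost every time, the equation holds in the
sense of distributions on Euclidean space. -/
def Coefficients.IsSolution {n : ℕ} (L : Coefficients n) (T : ℝ) (u : ℝ → L2 n) : Prop :=
  ∀ᵐ t, t ∈ Ioo 0 T →
    ((derivWithin u (Ico 0 T) t : L2 n) : TemperedDistribution (Space n) ℂ) + L.spatial t (u t) = 0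

end BackwardParabolic

/-!
The coefficients depend on time only, so the Fourier transform turns the equation into the ordinary
differential equations `û' = -σ(t, ξ) û`, one for each frequency `ξ`. Ellipticity, after absorbing
the first order terms into the principal part, confines `-Re σ(t, ξ)` between `2π²m|ξ|² - κ` and
`(4π²M + 2π²m)|ξ|² + κ`. Hence `|û(t, ξ)|` is at most `exp (O(|ξ|² t) + κt) |û(0, ξ)|` and at most
`exp (-2π²m|ξ|² (T - t) + κ(T - t)) |û(T, ξ)|`. In the geometric mean of the two bounds with a small
weight `θ` on the first one the quadratic exponents combine to something nonpositive, uniformly for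
`t ≤ T' < T`, and Hölder's inequality gives `‖u(t)‖ ≤ exp (κT) ‖u(0)‖ ^ θ ‖u(T)‖ ^ (1 - θ)`.
-/

namespace BackwardParabolic

open FourierTransform
open scoped InnerProductSpace

section Gronwall

theorem forall_mem_le_of_ae_le {X Y : Type*} [TopologicalSpace X] [MeasurableSpace X]
    [OpensMeasurableSpace X] {μ : Measure X} [μ.IsOpenPosMeasure] [LinearOrder Y]
    [TopologicalSpace Y] [OrderTopology Y] {f g : X → Y} {U : Set X} (hU : IsOpen U)
    (hf : ContinuousOn f U) (hg : ContinuousOn g U) (h : ∀ᵐ x ∂μ, x ∈ U → f x ≤ g x) :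
    ∀ x ∈ U, f x ≤ g x := by
  have hmin : (fun x ↦ min (f x) (g x)) =ᵐ[μ.restrict U] f :=
    (ae_restrict_iff' hU.measurableSet).mpr (h.mono fun x hx hxU ↦ min_eq_left (hx hxU))
  exact fun x hx ↦ min_eq_left_iff.mp (Measure.eqOn_open_of_ae_eq hmin hU (hf.inf hg) hf hx)

variable {a b k : ℝ}

theorem le_exp_mul_of_deriv_le {f : ℝ → ℝ} (hab : a ≤ b) (hf : ContinuousOn f (Icc a b))
    (hf' : DifferentiableOn ℝ f (Ioo a b)) (h : ∀ t ∈ Ioo a b, deriv f t ≤ k * f t) :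
    f b ≤ Real.exp (k * (b - a)) * f a := by
  have hderiv : ∀ t ∈ Ioo a b, HasDerivAt (fun t ↦ Real.exp (k * (b - t)) * f t)
      (Real.exp (k * (b - t)) * (deriv f t - k * f t)) t := fun t ht ↦ by
    have hexp : HasDerivAt (fun t ↦ Real.exp (k * (b - t))) (Real.exp (k * (b - t)) * (-k)) t := by
      simpa using (((hasDerivAt_id t).const_sub b).const_mul k).exp
    have hft := (hf'.differentiableAt (Ioo_mem_nhds ht.1 ht.2)).hasDerivAt
    exact (hexp.mul hft).congr_deriv (by ring)
  have hanti : AntitoneOn (fun t ↦ Real.exp (k * (b - t)) * f t) (Icc a b) := by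
    refine antitoneOn_of_deriv_nonpos (convex_Icc a b) (by fun_prop) ?_ ?_ <;> rw [interior_Icc]
    · exact fun t ht ↦ (hderiv t ht).differentiableAt.differentiableWithinAt
    · intro t ht
      rw [(hderiv t ht).deriv]
      exact mul_nonpos_of_nonneg_of_nonpos (Real.exp_pos _).le (sub_nonpos.mpr (h t ht))
  simpa using hanti (left_mem_Icc.mpr hab) (right_mem_Icc.mpr hab) hab

theorem norm_sq_le_exp_mul_of_ae_inner_deriv_le {H : Type*} [NormedAddCommGroup H]
    [InnerProductSpace ℝ H] {f : ℝ → H} (hab : a ≤ b) (hf : ContinuousOn f (Icc a b))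
    (hf' : ContDiffOn ℝ 1 f (Ioo a b))
    (h : ∀ᵐ t, t ∈ Ioo a b → ⟪f t, deriv f t⟫_ℝ ≤ k * ‖f t‖ ^ 2) :
    ‖f b‖ ^ 2 ≤ Real.exp (2 * k * (b - a)) * ‖f a‖ ^ 2 := by
  have hdiff := hf'.differentiableOn one_ne_zero
  have hle : ∀ t ∈ Ioo a b, ⟪f t, deriv f t⟫_ℝ ≤ k * ‖f t‖ ^ 2 :=
    forall_mem_le_of_ae_le isOpen_Ioo
      (hf'.continuousOn.inner (hf'.continuousOn_deriv_of_isOpen isOpen_Ioo le_rfl))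
      (continuousOn_const.mul (hf'.continuousOn.norm.pow 2)) h
  refine le_exp_mul_of_deriv_le (f := fun t ↦ ‖f t‖ ^ 2) hab (hf.norm.pow 2) (hdiff.norm_sq ℝ)
    fun t ht ↦ ?_
  rw [(hdiff.differentiableAt (Ioo_mem_nhds ht.1 ht.2)).hasDerivAt.norm_sq.deriv]
  linarith [hle t ht]

end Gronwall

section Hoelder

variable {α E F G : Type*} [MeasurableSpace α] {μ : Measure α} [NormedAddCommGroup E]
  [NormedAddCommGroup F] [NormedAddCommGroup G] {p : ℝ≥0∞} {θ : ℝ}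

theorem eLpNorm_le_mul_rpow_mul_rpow_of_ae_le {f : α → E} {g : α → F} {h : α → G} {c : ℝ≥0∞}
    (hf : AEStronglyMeasurable f μ) (hg : AEStronglyMeasurable g μ) (hθ : θ ∈ Icc 0 1)
    (hle : ∀ᵐ x ∂μ, ‖h x‖ₑ ≤ c * (‖f x‖ₑ ^ θ * ‖g x‖ₑ ^ (1 - θ))) :
    eLpNorm h p μ ≤ c * (eLpNorm f p μ ^ θ * eLpNorm g p μ ^ (1 - θ)) := by
  have hθ₀ := hθ.1
  have hθ₁ : 0 ≤ 1 - θ := sub_nonneg.mpr hθ.2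
  rcases eq_or_ne p 0 with rfl | hp₀
  · simp
  rcases eq_or_ne p ∞ with rfl | hp
  · simp only [eLpNorm_exponent_top]
    refine eLpNormEssSup_le_of_ae_enorm_bound ?_
    filter_upwards [hle, enorm_ae_le_eLpNormEssSup f μ, enorm_ae_le_eLpNormEssSup g μ]
      with x hx hfx hgx
    exact hx.trans (by gcongr)
  have hr : 0 < p.toReal := ENNReal.toReal_pos hp₀ hp
  simp only [eLpNorm_eq_lintegral_rpow_enorm_toReal hp₀ hp, one_div]
  set r := p.toReal
  have hcomm : ∀ (x : ℝ≥0∞) (s y : ℝ), (x ^ s) ^ y = (x ^ y) ^ s := fun x s y ↦ by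
    rw [← ENNReal.rpow_mul, ← ENNReal.rpow_mul, mul_comm]
  have hpow : ∀ x y z : ℝ≥0∞, (x * (y ^ θ * z ^ (1 - θ))) ^ r =
      x ^ r * ((y ^ r) ^ θ * (z ^ r) ^ (1 - θ)) := fun x y z ↦ by
    rw [ENNReal.mul_rpow_of_nonneg _ _ hr.le, ENNReal.mul_rpow_of_nonneg _ _ hr.le, hcomm,
      hcomm _ (1 - θ)]
  rw [ENNReal.rpow_inv_le_iff hr]
  calc ∫⁻ x, ‖h x‖ₑ ^ r ∂μ
      ≤ ∫⁻ x, c ^ r * ((‖f x‖ₑ ^ r) ^ θ * (‖g x‖ₑ ^ r) ^ (1 - θ)) ∂μ :=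
        lintegral_mono_ae (hle.mono fun x hx ↦ (ENNReal.rpow_le_rpow hx hr.le).trans_eq (hpow ..))
    _ = c ^ r * ∫⁻ x, (‖f x‖ₑ ^ r) ^ θ * (‖g x‖ₑ ^ r) ^ (1 - θ) ∂μ :=
        lintegral_const_mul'' _ (by fun_prop)
    _ ≤ c ^ r * ((∫⁻ x, ‖f x‖ₑ ^ r ∂μ) ^ θ * (∫⁻ x, ‖g x‖ₑ ^ r ∂μ) ^ (1 - θ)) := by
        gcongr
        exact ENNReal.lintegral_mul_norm_pow_le (by fun_prop) (by fun_prop) hθ₀ hθ₁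
          (add_sub_cancel _ _)
    _ = _ := by
        rw [hpow, ENNReal.rpow_inv_rpow hr.ne', ENNReal.rpow_inv_rpow hr.ne']

theorem norm_le_mul_rpow_mul_rpow_of_ae_le {f : Lp E p μ} {g : Lp F p μ} {h : Lp G p μ} {c : ℝ}
    (hc : 0 ≤ c) (hθ : θ ∈ Icc 0 1)
    (hle : ∀ᵐ x ∂μ, ‖h x‖ ≤ c * (‖f x‖ ^ θ * ‖g x‖ ^ (1 - θ))) :
    ‖h‖ ≤ c * (‖f‖ ^ θ * ‖g‖ ^ (1 - θ)) := by
  lift c to ℝ≥0 using hc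
  have hcoe : ∀ x y z : ℝ≥0, (x : ℝ≥0∞) ≤ c * ((y : ℝ≥0∞) ^ θ * (z : ℝ≥0∞) ^ (1 - θ)) ↔
      (x : ℝ) ≤ c * ((y : ℝ) ^ θ * (z : ℝ) ^ (1 - θ)) := fun x y z ↦ by
    rw [← ENNReal.coe_rpow_of_nonneg _ hθ.1, ← ENNReal.coe_rpow_of_nonneg _ (sub_nonneg.mpr hθ.2)]
    norm_cast
  refine (hcoe ‖h‖₊ ‖f‖₊ ‖g‖₊).mp ?_
  simp only [← enorm_eq_nnnorm, Lp.enorm_def]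
  exact eLpNorm_le_mul_rpow_mul_rpow_of_ae_le (Lp.aestronglyMeasurable f)
    (Lp.aestronglyMeasurable g) hθ (hle.mono fun x ↦ (hcoe ‖h x‖₊ ‖f x‖₊ ‖g x‖₊).mpr)

end Hoelder

section SquareIntegrable

variable {α E : Type*} [MeasurableSpace α] {μ : Measure α} [NormedAddCommGroup E]

theorem integrable_norm_sq (f : Lp E 2 μ) : Integrable (fun x ↦ ‖f x‖ ^ 2) μ :=
  (Lp.memLp f).integrable_norm_pow two_ne_zero

variable [InnerProductSpace ℝ E] {a b : ℝ} {f : ℝ → Lp E 2 μ} {p q : α → ℝ}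

theorem norm_sq_eq_integral (f : Lp E 2 μ) : ‖f‖ ^ 2 = ∫ x, ‖f x‖ ^ 2 ∂μ := by
  simp only [← real_inner_self_eq_norm_sq, L2.inner_def]

theorem inner_le_mul_norm_sq_of_ae_le {k : ℝ} {f g : Lp E 2 μ}
    (h : ∀ᵐ x ∂μ, ⟪f x, g x⟫_ℝ ≤ k * ‖f x‖ ^ 2) : ⟪f, g⟫_ℝ ≤ k * ‖f‖ ^ 2 := by
  rw [norm_sq_eq_integral, L2.inner_def, ← integral_const_mul]
  exact integral_mono_ae (L2.integrable_inner f g) ((integrable_norm_sq f).const_mul k) h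

theorem setIntegral_norm_sq_le_exp_mul (hab : a ≤ b) (hf : ContinuousOn f (Icc a b))
    (hf' : ContDiffOn ℝ 1 f (Ioo a b)) {k : ℝ} {S : Set α}
    (h : ∀ᵐ t, t ∈ Ioo a b → ∀ᵐ x ∂μ.restrict S, ⟪f t x, deriv f t x⟫_ℝ ≤ k * ‖f t x‖ ^ 2) :
    ∫ x in S, ‖f b x‖ ^ 2 ∂μ ≤ Real.exp (2 * k * (b - a)) * ∫ x in S, ‖f a x‖ ^ 2 ∂μ := by
  set R := LpToLpRestrictCLM α E ℝ μ 2 S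
  have hR : ∀ g, ∫ x in S, ‖g x‖ ^ 2 ∂μ = ‖R g‖ ^ 2 := fun g ↦ by
    rw [norm_sq_eq_integral]
    refine integral_congr_ae ?_
    filter_upwards [LpToLpRestrictCLM_coeFn ℝ S g] with x hx
    rw [hx]
  rw [hR, hR]
  refine norm_sq_le_exp_mul_of_ae_inner_deriv_le (f := R ∘ f) hab
    (R.continuous.comp_continuousOn hf) (R.contDiff.comp_contDiffOn hf') ?_
  filter_upwards [h] with t h ht
  have hft := (hf'.differentiableOn one_ne_zero).differentiableAt (Ioo_mem_nhds ht.1 ht.2)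
  rw [(R.hasFDerivAt.comp_hasDerivAt t hft.hasDerivAt).deriv]
  refine inner_le_mul_norm_sq_of_ae_le ?_
  filter_upwards [h ht, LpToLpRestrictCLM_coeFn ℝ S (f t),
    LpToLpRestrictCLM_coeFn ℝ S (deriv f t)] with x hx h₁ h₂
  rwa [Function.comp_apply, h₁, h₂]

-- A rate depending on `x` is reached through rational constants `k`: on the set where `q ≤ k` the
-- constant rate `k` is available, and only countably many null sets have to be discarded.
theorem ae_norm_le_exp_mul_norm_left (hab : a ≤ b) (hf : ContinuousOn f (Icc a b))
    (hf' : ContDiffOn ℝ 1 f (Ioo a b)) (hq : Measurable q)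
    (h : ∀ᵐ t, t ∈ Ioo a b → ∀ᵐ x ∂μ, ⟪f t x, deriv f t x⟫_ℝ ≤ q x * ‖f t x‖ ^ 2) :
    ∀ᵐ x ∂μ, ‖f b x‖ ≤ Real.exp (q x * (b - a)) * ‖f a x‖ := by
  have hrat : ∀ k : ℚ, ∀ᵐ x ∂μ, q x ≤ k →
      ‖f b x‖ ^ 2 ≤ Real.exp (2 * k * (b - a)) * ‖f a x‖ ^ 2 := fun k ↦ by
    have hk : MeasurableSet {x | q x ≤ k} := measurableSet_le hq measurable_const
    refine (ae_restrict_iff' hk).mp (ae_le_of_forall_setIntegral_le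
      (integrable_norm_sq _).restrict ((integrable_norm_sq _).restrict.const_mul _) fun S hS _ ↦ ?_)
    rw [integral_const_mul, Measure.restrict_restrict hS]
    refine setIntegral_norm_sq_le_exp_mul hab hf hf' ?_
    filter_upwards [h] with t h ht
    filter_upwards [ae_restrict_of_ae (h ht), ae_restrict_mem (hS.inter hk)] with x hx hmem
    exact hx.trans (mul_le_mul_of_nonneg_right hmem.2 (sq_nonneg _))
  filter_upwards [ae_all_iff.mpr hrat] with x hx
  have hclosed : IsClosed {k : ℝ | ‖f b x‖ ^ 2 ≤ Real.exp (2 * k * (b - a)) * ‖f a x‖ ^ 2} :=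
    isClosed_le continuous_const (by fun_prop)
  have hsub : Ioi (q x) ⊆ {k : ℝ | ‖f b x‖ ^ 2 ≤ Real.exp (2 * k * (b - a)) * ‖f a x‖ ^ 2} :=
    (Rat.denseRange_cast.open_subset_closure_inter isOpen_Ioi).trans <|
      hclosed.closure_subset_iff.mpr <| by rintro _ ⟨hk, k, rfl⟩; exact hx k hk.le
  have hsq : ‖f b x‖ ^ 2 ≤ Real.exp (2 * q x * (b - a)) * ‖f a x‖ ^ 2 :=
    hclosed.closure_subset_iff.mpr hsub (by simp)
  refine le_of_sq_le_sq ?_ (by positivity)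
  rwa [mul_pow, ← Real.exp_nat_mul, Nat.cast_two, ← mul_assoc]

theorem ae_norm_le_exp_mul_norm_right (hab : a ≤ b) (hf : ContinuousOn f (Icc a b))
    (hf' : ContDiffOn ℝ 1 f (Ioo a b)) (hp : Measurable p)
    (h : ∀ᵐ t, t ∈ Ioo a b → ∀ᵐ x ∂μ, p x * ‖f t x‖ ^ 2 ≤ ⟪f t x, deriv f t x⟫_ℝ) :
    ∀ᵐ x ∂μ, ‖f a x‖ ≤ Real.exp (-(p x * (b - a))) * ‖f b x‖ := by
  have hIoo : MapsTo Neg.neg (Ioo (-b) (-a)) (Ioo a b) :=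
    fun t ht ↦ ⟨lt_neg_of_lt_neg ht.2, neg_lt_of_neg_lt ht.1⟩
  have hIcc : MapsTo Neg.neg (Icc (-b) (-a)) (Icc a b) :=
    fun t ht ↦ ⟨le_neg_of_le_neg ht.2, neg_le_of_neg_le ht.1⟩
  have hrev := ae_norm_le_exp_mul_norm_left (f := fun t ↦ f (-t)) (neg_le_neg hab)
    (hf.comp continuousOn_neg hIcc) (hf'.comp contDiff_neg.contDiffOn hIoo) hp.neg ?_
  · simpa [sub_eq_add_neg, add_comm] using hrev
  · filter_upwards [(Measure.measurePreserving_neg volume).quasiMeasurePreserving.ae h] with t h ht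
    filter_upwards [h (hIoo ht), Lp.coeFn_neg (deriv f (-t))] with x hx hderiv
    rw [deriv_comp_neg, hderiv, Pi.neg_apply, inner_neg_right, Pi.neg_apply]
    linarith

theorem norm_le_exp_mul_rpow_mul_rpow {t θ C : ℝ} (hf : ContinuousOn f (Icc a b))
    (hf' : ContDiffOn ℝ 1 f (Ioo a b)) (hp : Measurable p) (hq : Measurable q)
    (hpf : ∀ᵐ t, t ∈ Ioo a b → ∀ᵐ x ∂μ, p x * ‖f t x‖ ^ 2 ≤ ⟪f t x, deriv f t x⟫_ℝ)
    (hqf : ∀ᵐ t, t ∈ Ioo a b → ∀ᵐ x ∂μ, ⟪f t x, deriv f t x⟫_ℝ ≤ q x * ‖f t x‖ ^ 2)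
    (ht : t ∈ Icc a b) (hθ : θ ∈ Icc 0 1)
    (hC : ∀ x, θ * (q x * (t - a)) - (1 - θ) * (p x * (b - t)) ≤ C) :
    ‖f t‖ ≤ Real.exp C * (‖f a‖ ^ θ * ‖f b‖ ^ (1 - θ)) := by
  have hleft := ae_norm_le_exp_mul_norm_left ht.1 (hf.mono (Icc_subset_Icc_right ht.2))
    (hf'.mono (Ioo_subset_Ioo_right ht.2)) hq
    (hqf.mono fun s hs hmem ↦ hs (Ioo_subset_Ioo_right ht.2 hmem))
  have hright := ae_norm_le_exp_mul_norm_right ht.2 (hf.mono (Icc_subset_Icc_left ht.1))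
    (hf'.mono (Ioo_subset_Ioo_left ht.1)) hp
    (hpf.mono fun s hs hmem ↦ hs (Ioo_subset_Ioo_left ht.1 hmem))
  have hθ₀ := hθ.1
  have hθ₁ : 0 ≤ 1 - θ := sub_nonneg.mpr hθ.2
  refine norm_le_mul_rpow_mul_rpow_of_ae_le (Real.exp_pos C).le hθ ?_
  filter_upwards [hleft, hright] with x hl hr
  calc ‖f t x‖ = ‖f t x‖ ^ θ * ‖f t x‖ ^ (1 - θ) := by
        rw [← Real.rpow_add_of_nonneg (norm_nonneg _) hθ₀ hθ₁, add_sub_cancel, Real.rpow_one]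
    _ ≤ (Real.exp (q x * (t - a)) * ‖f a x‖) ^ θ *
          (Real.exp (-(p x * (b - t))) * ‖f b x‖) ^ (1 - θ) := by
        gcongr
    _ = Real.exp (θ * (q x * (t - a)) - (1 - θ) * (p x * (b - t))) *
          (‖f a x‖ ^ θ * ‖f b x‖ ^ (1 - θ)) := by
        have hexp : θ * (q x * (t - a)) - (1 - θ) * (p x * (b - t)) =
            q x * (t - a) * θ + -(p x * (b - t)) * (1 - θ) := by ring
        rw [Real.mul_rpow (by positivity) (by positivity),
          Real.mul_rpow (by positivity) (by positivity), ← Real.exp_mul, ← Real.exp_mul, hexp,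
          Real.exp_add, mul_mul_mul_comm]
    _ ≤ Real.exp C * (‖f a x‖ ^ θ * ‖f b x‖ ^ (1 - θ)) := by
        gcongr
        exact hC x

end SquareIntegrable

section Symbol

theorem ae_eq_smul_of_toTemperedDistribution_eq_smulLeftCLM {E F : Type*} [NormedAddCommGroup E]
    [NormedSpace ℝ E] [FiniteDimensional ℝ E] [MeasurableSpace E] [BorelSpace E]
    [NormedAddCommGroup F] [NormedSpace ℂ F] [CompleteSpace F] {μ : Measure E}
    [μ.HasTemperateGrowth] [IsLocallyFiniteMeasure μ] {p q : ℝ≥0∞} [Fact (1 ≤ p)] [Fact (1 ≤ q)]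
    {σ : E → ℂ} (hσ : σ.HasTemperateGrowth) {f : Lp F p μ} {g : Lp F q μ}
    (h : (g : TemperedDistribution E F) =
      TemperedDistribution.smulLeftCLM F σ (f : TemperedDistribution E F)) :
    g =ᵐ[μ] fun x ↦ σ x • f x := by
  have hf : LocallyIntegrable f μ := (Lp.memLp f).locallyIntegrable Fact.out
  have hg : LocallyIntegrable g μ := (Lp.memLp g).locallyIntegrable Fact.out
  refine ae_eq_of_integral_contDiff_smul_eq hg (hf.continuous_smul hσ.1.continuous)
    fun φ hφ hφc ↦ ?_
  have hψc : HasCompactSupport (Complex.ofRealCLM ∘ φ) := hφc.comp_left rfl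
  have hψ : ContDiff ℝ (⊤ : ℕ∞) (Complex.ofRealCLM ∘ φ) := by fun_prop
  simpa [hσ, mul_smul, smul_comm (σ _)] using DFunLike.congr_fun h (hψc.toSchwartzMap hψ)

variable {n : ℕ}

/-- The Fourier multiplier `2πiξᵢ` of the partial derivative in the `i`-th direction. -/
noncomputable def partialSymbol (i : Fin n) (ξ : Space n) : ℂ := 2 * Real.pi * Complex.I * ξ i

theorem partialSymbol_eq_smul_inner (i : Fin n) :
    partialSymbol i = (2 * Real.pi * Complex.I) • fun ξ : Space n ↦ ((⟪ξ, e i⟫_ℝ : ℝ) : ℂ) := by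
  ext ξ
  simp [partialSymbol, EuclideanSpace.inner_single_right]

@[fun_prop]
theorem hasTemperateGrowth_partialSymbol (i : Fin n) :
    (partialSymbol i).HasTemperateGrowth := by
  rw [partialSymbol_eq_smul_inner]
  fun_prop

theorem partialSymbol_mul (i j : Fin n) (ξ : Space n) :
    partialSymbol i ξ * partialSymbol j ξ = ((-(4 * Real.pi ^ 2 * (ξ i * ξ j)) : ℝ) : ℂ) := by
  push_cast [partialSymbol]
  linear_combination (4 * (Real.pi : ℂ) ^ 2 * ξ i * ξ j) * Complex.I_sq

theorem norm_partialSymbol_le (i : Fin n) (ξ : Space n) :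
    ‖partialSymbol i ξ‖ ≤ 2 * Real.pi * ‖ξ‖ := by
  have hnorm : ‖partialSymbol i ξ‖ = 2 * Real.pi * ‖ξ i‖ := by
    simp [partialSymbol, abs_of_pos Real.pi_pos]
  rw [hnorm]
  gcongr
  exact PiLp.norm_apply_le ξ i

theorem fourier_lineDerivOp_single (w : TemperedDistribution (Space n) ℂ) (i : Fin n) :
    𝓕 (∂_{e i} w) = TemperedDistribution.smulLeftCLM ℂ (partialSymbol i) (𝓕 w) := by
  rw [TemperedDistribution.fourier_lineDerivOp_eq, partialSymbol_eq_smul_inner,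
    TemperedDistribution.smulLeftCLM_smul (by fun_prop), smul_apply]

namespace Coefficients

/-- The Fourier multiplier `σ(t, ξ)` of the spatial part of the operator at time `t`. -/
noncomputable def symbol (L : Coefficients n) (t : ℝ) (ξ : Space n) : ℂ :=
  (∑ i, ∑ j, L.a i j t * (partialSymbol j ξ * partialSymbol i ξ)) +
    (∑ j, L.b j t * partialSymbol j ξ) + L.c t

theorem hasTemperateGrowth_symbol (L : Coefficients n) (t : ℝ) :
    (L.symbol t).HasTemperateGrowth := by
  unfold symbol
  fun_prop

theorem fourier_spatial (L : Coefficients n) (t : ℝ) (w : TemperedDistribution (Space n) ℂ) :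
    𝓕 (L.spatial t w) = TemperedDistribution.smulLeftCLM ℂ (L.symbol t) (𝓕 w) := by
  have hpartial := hasTemperateGrowth_partialSymbol (n := n)
  have hsymbol : L.symbol t =
      (fun ξ ↦ ∑ i, (fun ξ ↦ ∑ j, ((L.a i j t : ℂ) • (partialSymbol j * partialSymbol i)) ξ) ξ) +
        (fun ξ ↦ ∑ j, (L.b j t • partialSymbol j) ξ) + fun _ ↦ L.c t := rfl
  have hrow : ∀ i, TemperedDistribution.smulLeftCLM ℂ
      (fun ξ ↦ ∑ j, ((L.a i j t : ℂ) • (partialSymbol j * partialSymbol i)) ξ) =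
        ∑ j, (L.a i j t : ℂ) • TemperedDistribution.smulLeftCLM ℂ
          (partialSymbol j * partialSymbol i) := fun i ↦ by
    rw [TemperedDistribution.smulLeftCLM_sum fun _ _ ↦ by fun_prop]
    simp only [TemperedDistribution.smulLeftCLM_smul ((hpartial _).mul (hpartial _))]
  rw [hsymbol, TemperedDistribution.smulLeftCLM_add (by fun_prop) (by fun_prop),
    TemperedDistribution.smulLeftCLM_add (by fun_prop) (by fun_prop),
    TemperedDistribution.smulLeftCLM_sum (fun _ _ ↦ by fun_prop),
    TemperedDistribution.smulLeftCLM_sum (fun _ _ ↦ by fun_prop)]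
  simp only [hrow, TemperedDistribution.smulLeftCLM_smul (hpartial _), spatial, add_apply,
    sum_apply, smul_apply, TemperedDistribution.smulLeftCLM_const, FourierTransform.fourier_add,
    FourierTransform.fourier_sum, FourierTransform.fourier_smul, fourier_lineDerivOp_single,
    map_smul, TemperedDistribution.smulLeftCLM_smulLeftCLM_apply (hpartial _) (hpartial _)]

theorem ae_fourier_eq (L : Coefficients n) {t : ℝ} {f g : L2 n}
    (h : (g : TemperedDistribution (Space n) ℂ) + L.spatial t f = 0) :
    (𝓕 g : L2 n) =ᵐ[volume] fun ξ ↦ -L.symbol t ξ * (𝓕 f : L2 n) ξ := by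
  have hσ := L.hasTemperateGrowth_symbol t
  refine ae_eq_smul_of_toTemperedDistribution_eq_smulLeftCLM hσ.neg ?_
  rw [← Lp.fourier_toTemperedDistribution_eq, eq_neg_of_add_eq_zero_left h,
    FourierTransform.fourier_neg, L.fourier_spatial, Lp.fourier_toTemperedDistribution_eq,
    TemperedDistribution.smulLeftCLM_neg hσ, neg_apply]

theorem re_principalSymbol (L : Coefficients n) (t : ℝ) (ξ : Space n) :
    (∑ i, ∑ j, L.a i j t * (partialSymbol j ξ * partialSymbol i ξ)).re =
      -(4 * Real.pi ^ 2 * ∑ i, ∑ j, L.a i j t * ξ i * ξ j) := by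
  simp only [Complex.re_sum, Finset.mul_sum, ← Finset.sum_neg_distrib, partialSymbol_mul,
    ← Complex.ofReal_mul, Complex.ofReal_re]
  exact Finset.sum_congr rfl fun i _ ↦ Finset.sum_congr rfl fun j _ ↦ by ring

/-- Ellipticity of the principal part at time `t`, with constants `m` and `M`, together with bounds
`B` and `C` for the coefficients of first and of zeroth order. -/
structure EllipticBoundsAt (L : Coefficients n) (t m M B C : ℝ) : Prop where
  lower (ξ : Space n) : m * ‖ξ‖ ^ 2 ≤ ∑ i, ∑ j, L.a i j t * ξ i * ξ j
  upper (ξ : Space n) : ∑ i, ∑ j, L.a i j t * ξ i * ξ j ≤ M * ‖ξ‖ ^ 2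
  norm_b_le (i : Fin n) : ‖L.b i t‖ ≤ B
  norm_c_le : ‖L.c t‖ ≤ C

variable {L : Coefficients n} {t m M B C : ℝ}

theorem Admissible.ellipticBoundsAt {T kA kB kC : ℝ} {ω : ℝ → ℝ}
    (hL : L.Admissible T kA kB kC ω) (ht : t ∈ Icc 0 T) :
    L.EllipticBoundsAt t kA kA⁻¹ kB kC :=
  ⟨hL.lower t ht, hL.upper t ht, hL.bound_b t ht, hL.bound_c t ht⟩

/-- The constant `κ` such that the terms of order at most one contribute at most
`2 * π ^ 2 * m * ‖ξ‖ ^ 2 + κ` to the real part of the symbol, when their coefficients are bounded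
by `B` and `C`. -/
noncomputable def growthConstant (n : ℕ) (m B C : ℝ) : ℝ := (B * n) ^ 2 / (2 * m) + C

theorem growthConstant_nonneg (hm : 0 ≤ m) (hC : 0 ≤ C) : 0 ≤ growthConstant n m B C := by
  unfold growthConstant
  positivity

namespace EllipticBoundsAt

theorem norm_lowerOrder_le (h : L.EllipticBoundsAt t m M B C) (ξ : Space n) :
    ‖(∑ j, L.b j t * partialSymbol j ξ) + L.c t‖ ≤ 2 * Real.pi * (B * n) * ‖ξ‖ + C := by
  refine (norm_add_le _ _).trans (add_le_add ?_ h.norm_c_le)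
  calc ‖∑ j, L.b j t * partialSymbol j ξ‖ ≤ ∑ _j : Fin n, B * (2 * Real.pi * ‖ξ‖) := by
        refine norm_sum_le_of_le _ fun j _ ↦ ?_
        rw [norm_mul]
        exact mul_le_mul (h.norm_b_le j) (norm_partialSymbol_le j ξ) (norm_nonneg _)
          ((norm_nonneg _).trans (h.norm_b_le j))
    _ = 2 * Real.pi * (B * n) * ‖ξ‖ := by
        rw [Finset.sum_const, Finset.card_univ, Fintype.card_fin, nsmul_eq_mul]
        ring

theorem norm_lowerOrder_le_add_growthConstant (h : L.EllipticBoundsAt t m M B C) (hm : 0 < m)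
    (ξ : Space n) : ‖(∑ j, L.b j t * partialSymbol j ξ) + L.c t‖ ≤
      2 * Real.pi ^ 2 * m * ‖ξ‖ ^ 2 + growthConstant n m B C := by
  have habsorb : 2 * Real.pi * (B * n) * ‖ξ‖ ≤
      2 * Real.pi ^ 2 * m * ‖ξ‖ ^ 2 + (B * n) ^ 2 / (2 * m) := by
    have hsq : 2 * Real.pi ^ 2 * m * ‖ξ‖ ^ 2 + (B * n) ^ 2 / (2 * m) -
        2 * Real.pi * (B * n) * ‖ξ‖ = (2 * Real.pi * m * ‖ξ‖ - B * n) ^ 2 / (2 * m) := by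
      field_simp
      ring
    have hnonneg : 0 ≤ (2 * Real.pi * m * ‖ξ‖ - B * n) ^ 2 / (2 * m) := by positivity
    linarith
  unfold growthConstant
  linarith [h.norm_lowerOrder_le ξ]

theorem le_neg_re_symbol (h : L.EllipticBoundsAt t m M B C) (hm : 0 < m) (ξ : Space n) :
    2 * Real.pi ^ 2 * m * ‖ξ‖ ^ 2 - growthConstant n m B C ≤ -(L.symbol t ξ).re := by
  have hlower := mul_le_mul_of_nonneg_left (h.lower ξ) (by positivity : 0 ≤ 4 * Real.pi ^ 2)
  have hre := (Complex.re_le_norm _).trans (h.norm_lowerOrder_le_add_growthConstant hm ξ)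
  rw [symbol, add_assoc, Complex.add_re, re_principalSymbol]
  linarith

theorem neg_re_symbol_le (h : L.EllipticBoundsAt t m M B C) (hm : 0 < m) (ξ : Space n) :
    -(L.symbol t ξ).re ≤
      2 * Real.pi ^ 2 * (2 * M + m) * ‖ξ‖ ^ 2 + growthConstant n m B C := by
  have hupper := mul_le_mul_of_nonneg_left (h.upper ξ) (by positivity : 0 ≤ 4 * Real.pi ^ 2)
  have hre := (abs_le.mp ((Complex.abs_re_le_norm _).trans
    (h.norm_lowerOrder_le_add_growthConstant hm ξ))).1
  rw [symbol, add_assoc, Complex.add_re, re_principalSymbol]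
  linarith

end EllipticBoundsAt

end Coefficients

end Symbol

section Stability

variable {n : ℕ} {L : Coefficients n} {T m M B C : ℝ} {u : ℝ → L2 n}

theorem real_inner_mul_self (w z : ℂ) : ⟪z, w * z⟫_ℝ = w.re * ‖z‖ ^ 2 := by
  rw [Complex.inner, mul_assoc, Complex.mul_conj', ← Complex.ofReal_pow, Complex.re_mul_ofReal]

theorem Coefficients.IsSolution.ae_inner_deriv_fourier_eq (hsol : L.IsSolution T u)
    (hu : DifferentiableOn ℝ u (Ioo 0 T)) :
    ∀ᵐ t, t ∈ Ioo 0 T → ∀ᵐ ξ, ⟪(𝓕 (u t) : L2 n) ξ, deriv (fun s ↦ (𝓕 (u s) : L2 n)) t ξ⟫_ℝ =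
      -(L.symbol t ξ).re * ‖(𝓕 (u t) : L2 n) ξ‖ ^ 2 := by
  filter_upwards [hsol] with t hsol ht
  have hderiv : deriv (fun s ↦ (𝓕 (u s) : L2 n)) t = 𝓕 (derivWithin u (Ico 0 T) t) := by
    rw [derivWithin_of_mem_nhds (Ico_mem_nhds ht.1 ht.2)]
    exact (((fourierCLM ℂ (L2 n)).restrictScalars ℝ).hasFDerivAt.comp_hasDerivAt t
      (hu.differentiableAt (Ioo_mem_nhds ht.1 ht.2)).hasDerivAt).deriv
  filter_upwards [L.ae_fourier_eq (hsol ht)] with ξ hξ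
  rw [hderiv, hξ, real_inner_mul_self, Complex.neg_re]

theorem Coefficients.IsSolution.norm_le_exp_mul_rpow_mul_rpow (hsol : L.IsSolution T u)
    (hu : ContinuousOn u (Icc 0 T)) (hu' : ContDiffOn ℝ 1 u (Ioo 0 T))
    (hL : ∀ᵐ t, t ∈ Ioo 0 T → L.EllipticBoundsAt t m M B C) (hm : 0 < m) (hC : 0 ≤ C) {t θ : ℝ}
    (ht : t ∈ Icc 0 T) (hθ : θ ∈ Icc 0 1) (htθ : θ * ((2 * M + m) * t) ≤ (1 - θ) * (m * (T - t))) :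
    ‖u t‖ ≤ Real.exp (growthConstant n m B C * T) * (‖u 0‖ ^ θ * ‖u T‖ ^ (1 - θ)) := by
  let F := (fourierCLM ℂ (L2 n)).restrictScalars ℝ
  have hinner := hsol.ae_inner_deriv_fourier_eq (hu'.differentiableOn one_ne_zero)
  have hexponent : ∀ ξ : Space n,
      θ * ((2 * Real.pi ^ 2 * (2 * M + m) * ‖ξ‖ ^ 2 + growthConstant n m B C) * (t - 0)) -
        (1 - θ) * ((2 * Real.pi ^ 2 * m * ‖ξ‖ ^ 2 - growthConstant n m B C) * (T - t)) ≤
      growthConstant n m B C * T := fun ξ ↦ by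
    have hquad := mul_le_mul_of_nonneg_left htθ (by positivity : 0 ≤ 2 * Real.pi ^ 2 * ‖ξ‖ ^ 2)
    have hweight : θ * t + (1 - θ) * (T - t) ≤ T := by
      nlinarith [hθ.1, hθ.2, ht.1, ht.2]
    have hconst := mul_le_mul_of_nonneg_left hweight
      (growthConstant_nonneg (n := n) (B := B) hm.le hC)
    linarith
  have hmain := BackwardParabolic.norm_le_exp_mul_rpow_mul_rpow (f := F ∘ u)
    (F.continuous.comp_continuousOn hu) (F.contDiff.comp_contDiffOn hu')
    (by fun_prop) (by fun_prop) ?_ ?_ ht hθ hexponent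
  · simpa only [Function.comp_apply, F, ContinuousLinearMap.coe_restrictScalars', fourierCLM_apply,
      Lp.norm_fourier_eq] using hmain
  · filter_upwards [hinner, hL] with s hs hLs hmem
    filter_upwards [hs hmem] with ξ hξ
    refine (mul_le_mul_of_nonneg_right ((hLs hmem).le_neg_re_symbol hm ξ) (sq_nonneg _)).trans_eq ?_
    exact hξ.symm
  · filter_upwards [hinner, hL] with s hs hLs hmem
    filter_upwards [hs hmem] with ξ hξ
    refine hξ.trans_le ?_
    exact mul_le_mul_of_nonneg_right ((hLs hmem).neg_re_symbol_le hm ξ) (sq_nonneg _)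

theorem exists_hoelder_exponent {T' : ℝ} (hm : 0 < m) (hM : 0 ≤ M) (hT' : 0 ≤ T') (hT'T : T' < T) :
    ∃ θ ∈ Ioc (0 : ℝ) 1, ∀ t ∈ Icc 0 T',
      θ * ((2 * M + m) * t) ≤ (1 - θ) * (m * (T - t)) := by
  set gap := m * (T - T')
  set cost := (2 * M + m) * T'
  have hgap : 0 < gap := mul_pos hm (sub_pos.mpr hT'T)
  have hcost : 0 ≤ cost := by positivity
  have hcompl : 1 - gap / (gap + cost) = cost / (gap + cost) := by
    field_simp
    ring
  refine ⟨gap / (gap + cost), ⟨by positivity, ?_⟩, fun t ht ↦ ?_⟩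
  · exact (div_le_one (by positivity)).mpr (by linarith)
  · rw [hcompl]
    calc gap / (gap + cost) * ((2 * M + m) * t) ≤ gap / (gap + cost) * cost := by
          unfold cost
          gcongr
          exact ht.2
      _ = cost / (gap + cost) * gap := by ring
      _ ≤ cost / (gap + cost) * (m * (T - t)) := by
          unfold gap
          gcongr
          exact ht.2

end Stability

end BackwardParabolic

theorem mainTheorem1_general (n : ℕ) {m M B C T T' D : ℝ} (hm : 0 < m) (hM : 0 ≤ M) (hC : 0 ≤ C)
    (hT' : 0 ≤ T') (hT'T : T' < T) (hD : 0 < D) :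
    ∃ G : ℝ≥0 → ℝ≥0, StrictMono G ∧ Continuous G ∧ G 0 = 0 ∧
      ∀ L : BackwardParabolic.Coefficients n,
        (∀ᵐ t, t ∈ Set.Ioo 0 T → L.EllipticBoundsAt t m M B C) →
        ∀ u : ℝ → BackwardParabolic.L2 n, ContinuousOn u (Set.Icc 0 T) →
          ContDiffOn ℝ 1 u (Set.Ioo 0 T) → L.IsSolution T u → ‖u T‖ ≤ D →
            (⨆ t ∈ Set.Icc 0 T', ‖u t‖ₑ ^ 2) ≤ (G (‖u 0‖₊ ^ 2) : ℝ≥0∞) := by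
  obtain ⟨θ, ⟨hθ₀, hθ₁⟩, hθ⟩ := BackwardParabolic.exists_hoelder_exponent hm hM hT' hT'T
  set K := Real.exp (BackwardParabolic.Coefficients.growthConstant n m B C * T) * D ^ (1 - θ)
  have hK : 0 < K := by positivity
  refine ⟨fun s ↦ (K ^ 2).toNNReal * s ^ θ,
    (NNReal.strictMono_rpow_of_pos hθ₀).const_mul (Real.toNNReal_pos.mpr (pow_pos hK 2)),
    continuous_const.mul (NNReal.continuous_rpow_const hθ₀.le), by simp [hθ₀.ne'],
    fun L hL u hu hu' hsol hD' ↦ iSup₂_le fun t ht ↦ ?_⟩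
  have hnorm : ‖u t‖ ≤ K * ‖u 0‖ ^ θ := by
    refine (hsol.norm_le_exp_mul_rpow_mul_rpow hu hu' hL hm hC ⟨ht.1, ht.2.trans hT'T.le⟩
      ⟨hθ₀.le, hθ₁⟩ (hθ t ht)).trans ?_
    rw [mul_assoc, mul_comm (‖u 0‖ ^ θ)]
    have : 0 ≤ 1 - θ := sub_nonneg.mpr hθ₁
    gcongr
  have hsq : ‖u t‖ ^ 2 ≤ K ^ 2 * (‖u 0‖ ^ 2) ^ θ := by
    calc ‖u t‖ ^ 2 ≤ (K * ‖u 0‖ ^ θ) ^ 2 := by gcongr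
      _ = K ^ 2 * (‖u 0‖ ^ 2) ^ θ := by
        rw [mul_pow, Real.rpow_pow_comm (norm_nonneg _)]
  rw [enorm_eq_nnnorm, ← ENNReal.coe_pow, ENNReal.coe_le_coe, ← NNReal.coe_le_coe]
  simpa [Real.coe_toNNReal _ (sq_nonneg K)] using hsq

theorem mainTheorem1 (n : ℕ) (kA kB kC T T' D : ℝ) (ω : ℝ → ℝ)
    (hkA : 0 < kA) (hkB : 0 < kB) (hkC : 0 < kC)
    (hω : BackwardParabolic.IsModulusOfContinuity ω)
    (hO : BackwardParabolic.OsgoodCondition ω)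
    (hT' : 0 < T') (hT'T : T' < T) (hD : 0 < D) :
    ∃ ρ' : ℝ, 0 < ρ' ∧ ∃ G : ℝ≥0 → ℝ≥0, StrictMono G ∧ Continuous G ∧ G 0 = 0 ∧
      ∀ L : BackwardParabolic.Coefficients n, L.Admissible T kA kB kC ω →
        ∀ u : ℝ → BackwardParabolic.L2 n, BackwardParabolic.MemH0 T u → L.IsSolution T u →
          (∀ t ∈ Set.Icc 0 T, ‖u t‖ ≤ D) → ‖u 0‖ ≤ ρ' →
            (⨆ t ∈ Set.Icc 0 T', ‖u t‖ₑ ^ 2) ≤ (G (‖u 0‖₊ ^ 2) : ℝ≥0∞) := by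
  obtain ⟨G, hmono, hcont, hzero, hG⟩ :=
    mainTheorem1_general n (B := kB) hkA (inv_nonneg.mpr hkA.le) hkC.le hT'.le hT'T hD
  exact ⟨1, one_pos, G, hmono, hcont, hzero, fun L hL u hu hsol hbound _ ↦
    hG L (ae_of_all _ fun t ht ↦ hL.ellipticBoundsAt (Set.Ioo_subset_Icc_self ht)) u
      hu.continuousOn (hu.contDiffOn.mono Set.Ioo_subset_Ico_self) hsol
      (hbound T (Set.right_mem_Icc.mpr (hT'.trans hT'T).le))⟩
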